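/- \textbf{Theorem (Ellipticity on the discrete kernel).} \emph{Geometry.} Let $n\in\{2,3\}$ and let $Y\subset\mathbb R^n$ be a bounded domain with a part $\partial_uY\subseteq\partial Y$ of its boundary. Let $\Omega_i$, $i\in I$ ($I$ finite), be mutually disjoint flat manifolds in $Y$, of dimension $d_i\in\{0,\dots,n\}$ and relatively open in their planes, such that $\bigcup_{d_i=n}\Omega_i=\operatorname{int}(Y\setminus\bigcup_{d_i<n}\Omega_i)$. For $i\in I$ let $\hat J_i$ index the sides of $\Omega_i$: each $j\in\hat J_i$ is an interface $\Gamma_j$ that coincides with $\Omega_i$ and lies on the boundary of a manifold $\Omega_{\hat\jmath}$ with $d_{\hat\jmath}=d_i+1$, which it touches from one side, with unit normal $\boldsymbol n$ tangent to $\Omega_{\hat\jmath}$ and outward with respect to it. Every side of $\Omega_i$ at which a manifold of dimension $d_i+1$ is adjacent has exactly one index, and $\hat J_i\neq\emptyset$ if $d_i<n$. Let $\check J_i$ index the interfaces $\Gamma_j\subseteq\partial\Omega_i$, i.e. those with $\hat\jmath=i$. Put $\partial_u\Omega_i=\partial_uY\cap\partial\Omega_i$ and $\partial_\sigma\Omega_i=\partial\Omega_i\setminus(\bigcup_{j\in\check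 J_i}\Gamma_j\cup\partial_u\Omega_i)$. \emph{Spaces.} Let $\Sigma=\prod_i\Sigma_i$, $\boldsymbol U=\prod_i\boldsymbol U_i$, $R=\prod_iR_i$, where $\boldsymbol U_i=L^2(\Omega_i)^n$, $R_i=L^2(\Omega_i)^{d_i(d_i-1)/2}$, and $\Sigma_i$ is the space of $n\times d_i$ matrix fields $\tau_i\in H(\operatorname{div},\Omega_i)^n$ (row-wise) with $\boldsymbol n\cdot\tau_i|_{\partial_\sigma\Omega_i}=0$ and $\boldsymbol n\cdot\tau_i|_{\Gamma_j}\in L^2(\Gamma_j)^n$ for $j\in\check J_i$, the normal traces being understood weakly, through Green's formula (the factors are trivial where $d_i=0$, respectively $d_i\le1$). Put $(\mathfrak D\cdot\sigma)_i=\nabla\cdot\sigma_i-\sum_{j\in\hat J_i}(\boldsymbol n\cdot\sigma_{\hat\jmath})|_{\Gamma_j}$. With $b$ the components of the tangential rows of $\sigma_i$ in an orthonormal tangent basis, $(\operatorname{skw}\sigma)_i$ is $b_{12}-b_{21}$ if $d_i=2$, $[b_{23}-b_{32},\,b_{31}-b_{13},\,b_{12}-b_{21}]^T$ if $d_i=3$,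 and void otherwise. Let $(\cdot,\cdot)_\Omega$ and $(\cdot,\cdot)_\Gamma$ be the sums of the $L^2$ inner products over all $\Omega_i$, respectively over all $\Gamma_j$, $j\in\hat J_i$, $i\in I$, and let $\|\sigma\|_{\Omega\times\Gamma}^2=\|\sigma\|_\Omega^2+\|\boldsymbol n\cdot\sigma\|_\Gamma^2$. \emph{Scaling and material.} Let $\epsilon_i>0$ be constants with $\epsilon_i=1$ if $d_i=n$; let $(\hat\epsilon_{\max})_i=\max_{j\in\hat J_i}\epsilon_{\hat\jmath}$ if $d_i<n$ and $(\hat\epsilon_{\max})_i=1$ if $d_i=n$. Let $\mathcal A$ be a linear stress-strain operator from $\Sigma$ to square-integrable fields on $\Omega\times\Gamma$ ($n\times d_i$ matrix fields on each $\Omega_i$, vector fields in $L^2(\Gamma_j)^n$ on each $\Gamma_j$), and $\mathfrak A=\epsilon\mathcal A\epsilon^{-1}$ (with $\epsilon=\epsilon_{\hat\jmath}$ on $\Gamma_j$). Put $$a(\sigma;\tau)=(\mathfrak A\sigma|_\Omega,\tau)_\Omega+(\mathfrak A\sigma|_\Gamma,\boldsymbol n\cdot\tau)_\Gamma,\qquad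 b(\sigma;\boldsymbol v,s)=(\mathfrak D\cdot\epsilon\sigma,\boldsymbol v)_\Omega+(\operatorname{skw}\epsilon\sigma,s)_\Omega,$$ $$\|\sigma\|_\Sigma^2=\|\sigma\|_\Omega^2+\|\boldsymbol n\cdot\sigma\|_\Gamma^2+\|\hat\epsilon_{\max}^{-1}\,\mathfrak D\cdot\epsilon\sigma\|_\Omega^2,$$ and assume that $a(\sigma;\tau)\le M\|\sigma\|_{\Omega\times\Gamma}\|\tau\|_{\Omega\times\Gamma}$ and $a(\sigma;\sigma)\ge\alpha\|\sigma\|_{\Omega\times\Gamma}^2$ for all $\sigma,\tau\in\Sigma$, with constants $M$ and $\alpha>0$. \emph{Claim.} There is a constant $C>0$, depending only on the geometry, $M$ and $\alpha$ (in particular not on $\epsilon$ nor on the discrete spaces, hence not on the mesh size), such that the following holds. Let $\Sigma_h=\prod_i\Sigma_{i,h}$, $\boldsymbol U_h=\prod_i\boldsymbol U_{i,h}$, $R_h=\prod_iR_{i,h}$ with linear subspaces $\Sigma_{i,h}\subseteq\Sigma_i$, $\boldsymbol U_{i,h}\subseteq\boldsymbol U_i$, $R_{i,h}\subseteq R_i$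 such that for each $i\in I$ $$\nabla\cdot\Sigma_{i,h}\subseteq\boldsymbol U_{i,h}\qquad\text{and}\qquad(\boldsymbol n\cdot\Sigma_{\hat\jmath,h})|_{\Gamma_j}=\boldsymbol U_{i,h}\quad\text{for all }j\in\hat J_i.$$ If $\sigma_h\in\Sigma_h$ satisfies $b(\sigma_h;\boldsymbol v_h,s_h)=0$ for all $(\boldsymbol v_h,s_h)\in\boldsymbol U_h\times R_h$, then $$a(\sigma_h;\sigma_h)\ge C\,\|\sigma_h\|_\Sigma^2.$$ -/

import Mathlib

open MeasureTheory Filter Topology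
open scoped ContDiff InnerProductSpace

/-- Euclidean `d`-space. -/
abbrev Euc (d : ℕ) : Type := EuclideanSpace ℝ (Fin d)

/-- Let `f`, `g` be isometric parametrizations of flat planes of dimension `d`, `e` in `ℝⁿ`, and `O` an
open set of parameters of the second plane. `IsSideNormal f g O ν y` says: the first plane lies
in the second one, `ν` is a unit vector tangent to the second plane and normal to the first, and near
the point `f y` the part of the second plane on the side `-ν` of the first plane belongs to `g(O)`. So `f y` is
a boundary point of `g(O)`, seen from the side on which `ν` is the outward normal. -/
def IsSideNormal {n d e : ℕ} (f : Euc d →ᵃⁱ[ℝ] Euc n) (g : Euc e →ᵃⁱ[ℝ] Euc n)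
    (O : Set (Euc e)) (ν : Euc n) (y : Euc d) : Prop :=
  Set.range f ⊆ Set.range g ∧ ‖ν‖ = 1 ∧ (∃ w, g.linearIsometry w = ν) ∧
    (∀ v, ⟪ν, f.linearIsometry v⟫_ℝ = 0) ∧
    ∃ r > 0, ∀ z, dist (g z) (f y) < r → ⟪g z - f y, ν⟫_ℝ < 0 → z ∈ O

/-- A mixed-dimensional geometry in a bounded `n`-dimensional domain `Y`: finitely many flat, mutually disjoint
manifolds `Ω i` of dimensions `dim i ≤ n`, each given by an isometric affine parametrization `chart i` of
its plane and a (relatively) open set `dom i` of parameters; and for each `i` the finite set `J i` of its sides.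
A side `j : J i` is an interface `Γ j` that coincides with `Ω i` and that lies on the boundary of the
manifold `Ω (hi i j)`, one dimension higher, with outward unit normal `normal i j`. One and the same manifold
may border on both sides of `Ω i`. -/
structure MixedDimGeometry (n : ℕ) where
  /-- the domain -/
  Y : Set (Euc n)
  isOpen_Y : IsOpen Y
  isBounded_Y : Bornology.IsBounded Y
  /-- the part of the boundary of the domain where the displacement is prescribed; on the rest of the
  boundary the normal stress is zero -/
  boundaryU : Set (Euc n)
  boundaryU_subset : boundaryU ⊆ frontier Y
  /-- index set of the manifolds -/
  I : Type
  [fintypeI : Fintype I]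
  dim : I → ℕ
  dim_le : ∀ i, dim i ≤ n
  chart : ∀ i, Euc (dim i) →ᵃⁱ[ℝ] Euc n
  dom : ∀ i, Set (Euc (dim i))
  isOpen_dom : ∀ i, IsOpen (dom i)
  nonempty_dom : ∀ i, (dom i).Nonempty
  image_subset : ∀ i, chart i '' dom i ⊆ Y
  disjoint_image : ∀ i k, i ≠ k → Disjoint (chart i '' dom i) (chart k '' dom k)
  /-- the surrounding medium is what remains of the domain -/
  medium_eq : (⋃ i ∈ {i | dim i = n}, chart i '' dom i) =
    interior (Y \ ⋃ i ∈ {i | dim i < n}, chart i '' dom i)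
  /-- the sides of the `i`-th manifold -/
  J : I → Type
  [fintypeJ : ∀ i, Fintype (J i)]
  /-- the higher-dimensional neighbour across a side -/
  hi : ∀ i, J i → I
  dim_hi : ∀ i j, dim (hi i j) = dim i + 1
  /-- unit normal on the interface, tangent to the neighbour and outward with respect to it -/
  normal : ∀ i, J i → Euc n
  isSideNormal : ∀ i j, ∀ y ∈ dom i,
    IsSideNormal (chart i) (chart (hi i j)) (dom (hi i j)) (normal i j) y
  /-- each side has one index -/
  side_injective : ∀ i j j', hi i j = hi i j' → normal i j = normal i j' → j = j'
  /-- each side has an index -/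
  side_surjective : ∀ i k, dim k = dim i + 1 → ∀ y ∈ dom i, ∀ ν,
    IsSideNormal (chart i) (chart k) (dom k) ν y → ∃ j, hi i j = k ∧ normal i j = ν
  /-- each lower-dimensional manifold is adjacent to a manifold of one dimension higher -/
  nonempty_J : ∀ i, dim i < n → Nonempty (J i)

/-- `skw` of a `2 × 2` matrix. -/
noncomputable def skwTwo : Matrix (Fin 2) (Fin 2) ℝ →ₗ[ℝ] Euc 1 where
  toFun b := !₂[b 0 1 - b 1 0]
  map_add' b c := by
    ext m
    fin_cases m
    simp
    ring
  map_smul' a b := by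
    ext m
    fin_cases m
    simp
    ring

/-- `skw` of a `3 × 3` matrix. -/
noncomputable def skwThree : Matrix (Fin 3) (Fin 3) ℝ →ₗ[ℝ] Euc 3 where
  toFun b := !₂[b 1 2 - b 2 1, b 2 0 - b 0 2, b 0 1 - b 1 0]
  map_add' b c := by
    ext m
    fin_cases m <;> simp <;> ring
  map_smul' a b := by
    ext m
    fin_cases m <;> simp <;> ring

/-- `skw` of a `d × d` matrix: a vector for `d = 3`, a scalar for `d = 2`, and void for `d = 0, 1`
(dimensions `d > 3` are not used). -/
noncomputable def skwMat : (d : ℕ) → Matrix (Fin d) (Fin d) ℝ →ₗ[ℝ] Euc (d.choose 2)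
  | 2 => skwTwo
  | 3 => skwThree
  | _ => 0

namespace MixedDimGeometry

attribute [instance] MixedDimGeometry.fintypeI MixedDimGeometry.fintypeJ

variable {n : ℕ} (G : MixedDimGeometry n)

/-- The Lebesgue measure of the `i`-th manifold, in its (isometric) parametrization; the Dirac measure if the
manifold is a point. -/
noncomputable def vol (i : G.I) : Measure (Euc (G.dim i)) := volume.restrict (G.dom i)

/-- The values of the stress on `Ω i`: the `n × dim i` matrices with the Frobenius inner product. The rows
belong to the coordinates of `ℝⁿ`, the columns to the tangential basis vectors, i.e. to the coordinates of
the parametrization. The type is trivial for a point. -/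
abbrev StressVal (i : G.I) : Type := EuclideanSpace ℝ (Fin n × Fin (G.dim i))

/-- `n × dim i` matrix-valued `L²` functions on `Ω i`. -/
abbrev L2Mat (i : G.I) : Type := Lp (G.StressVal i) 2 (G.vol i)

/-- `L²(Ω i)ⁿ`. -/
abbrev L2Vec (i : G.I) : Type := Lp (Euc n) 2 (G.vol i)

/-- `L²(Ω i)` to the power `k_d = d (d - 1) / 2`, with `d = dim i`. The type is trivial for `d = 0, 1`. -/
abbrev L2Skw (i : G.I) : Type := Lp (Euc ((G.dim i).choose 2)) 2 (G.vol i)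

/-- The interfaces on the boundary of `Ω k`: the sides `j` of the manifolds `Ω i` that have
`Ω k` as their neighbour. -/
abbrev InterfaceOf (k : G.I) : Type := {p : (i : G.I) × G.J i // G.hi p.1 p.2 = k}

noncomputable instance (k : G.I) : Fintype (G.InterfaceOf k) := Fintype.ofFinite _

/-- The part of the boundary of `Ω k`, in parameters, where the displacement is prescribed. -/
def boundaryUOf (k : G.I) : Set (Euc (G.dim k)) :=
  frontier (G.dom k) ∩ G.chart k ⁻¹' G.boundaryU

/-- A test function on `Ω k` for the normal trace: smooth, bounded with bounded gradient, and zero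
near the part of the boundary where the displacement is prescribed. It comes with its traces on the
interfaces on the boundary of `Ω k`, each one taken from its own side. (These traces always exist
and are unique, continuous and bounded, because the function is Lipschitz near the interface on each side.) -/
structure TestFunction (k : G.I) where
  toFun : Euc (G.dim k) → ℝ
  smooth : ContDiffOn ℝ ∞ toFun (G.dom k)
  bounded : ∃ c : ℝ, ∀ x ∈ G.dom k, |toFun x| ≤ c ∧ ‖fderiv ℝ toFun x‖ ≤ c
  vanish : ∃ N : Set (Euc (G.dim k)), IsOpen N ∧ G.boundaryUOf k ⊆ N ∧
    ∀ x ∈ G.dom k ∩ N, toFun x = 0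
  trace : ∀ p : G.InterfaceOf k, Euc (G.dim p.1.1) → ℝ
  tendsto_trace : ∀ (p : G.InterfaceOf k), ∀ y ∈ G.dom p.1.1,
    Tendsto toFun
      (comap (G.chart k) (𝓝[{x | ⟪x - G.chart p.1.1 y, G.normal p.1.1 p.1.2⟫_ℝ < 0}]
        (G.chart p.1.1 y)))
      (𝓝 (trace p y))
  continuousOn_trace : ∀ p : G.InterfaceOf k, ContinuousOn (trace p) (G.dom p.1.1)
  bounded_trace : ∀ p : G.InterfaceOf k, ∃ c : ℝ, ∀ y ∈ G.dom p.1.1, |trace p y| ≤ c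

/-- Green's formula, row by row: `g` is the weak divergence of `τ` on `Ω k`, the normal trace `n · τ` on each
interface on the boundary of `Ω k` is the given `L²` function `t p`, and `n · τ` is zero on the rest
of the boundary of `Ω k`, except for the part where the displacement is prescribed. -/
def HasDivTrace (k : G.I) (τ : G.L2Mat k) (g : G.L2Vec k)
    (t : ∀ p : G.InterfaceOf k, G.L2Vec p.1.1) : Prop :=
  ∀ (φ : G.TestFunction k) (r : Fin n),
    ∫ x, ((∑ l, fderiv ℝ φ.toFun x (EuclideanSpace.single l 1) * τ x (r, l)) + φ.toFun x * g x r)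
        ∂(G.vol k) =
      ∑ p : G.InterfaceOf k, ∫ y, φ.trace p y * t p y r ∂(G.vol p.1.1)

theorem isFiniteMeasure_vol (i : G.I) : IsFiniteMeasure (G.vol i) := by
  have hb : Bornology.IsBounded (G.dom i) := by
    have h := G.isBounded_Y.subset (G.image_subset i)
    obtain ⟨c, hc⟩ := Metric.isBounded_iff.1 h
    refine Metric.isBounded_iff.2 ⟨c, fun x hx y hy => ?_⟩
    have := hc (Set.mem_image_of_mem _ hx) (Set.mem_image_of_mem _ hy)
    rwa [(G.chart i).dist_map] at this
  exact ⟨by simpa [vol] using hb.measure_lt_top⟩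

theorem integrable_mul_of_bounded (i : G.I) {f h : Euc (G.dim i) → ℝ} {c : ℝ}
    (hf : ContinuousOn f (G.dom i)) (hc : ∀ x ∈ G.dom i, |f x| ≤ c) (hh : MemLp h 2 (G.vol i)) :
    Integrable (fun x => f x * h x) (G.vol i) := by
  have := G.isFiniteMeasure_vol i
  refine (hh.integrable one_le_two).bdd_mul (c := c)
    (hf.aestronglyMeasurable (G.isOpen_dom i).measurableSet) ?_
  refine (ae_restrict_iff' (G.isOpen_dom i).measurableSet).2 (Eventually.of_forall fun x hx => ?_)
  exact hc x hx

theorem memLp_coord {i : G.I} {ι : Type} [Fintype ι] (f : Lp (EuclideanSpace ℝ ι) 2 (G.vol i))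
    (m : ι) : MemLp (fun x => f x m) 2 (G.vol i) :=
  (PiLp.proj (𝕜 := ℝ) 2 (fun _ : ι => ℝ) m).comp_memLp' (Lp.memLp f)

theorem integrable_grad {k : G.I} (φ : G.TestFunction k) (τ : G.L2Mat k) (r : Fin n)
    (l : Fin (G.dim k)) :
    Integrable (fun x => fderiv ℝ φ.toFun x (EuclideanSpace.single l 1) * τ x (r, l))
      (G.vol k) := by
  obtain ⟨c, hc⟩ := φ.bounded
  refine G.integrable_mul_of_bounded k (c := c) ?_ (fun x hx => ?_) (G.memLp_coord τ (r, l))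
  · exact (φ.smooth.continuousOn_fderiv_of_isOpen (G.isOpen_dom k) (by simp)).clm_apply
      continuousOn_const
  · have := (fderiv ℝ φ.toFun x).le_opNorm (EuclideanSpace.single l 1)
    simp only [PiLp.norm_single, norm_one, mul_one, Real.norm_eq_abs] at this
    exact this.trans (hc x hx).2

theorem integrable_fun {k : G.I} (φ : G.TestFunction k) (g : G.L2Vec k) (r : Fin n) :
    Integrable (fun x => φ.toFun x * g x r) (G.vol k) := by
  obtain ⟨c, hc⟩ := φ.bounded
  exact G.integrable_mul_of_bounded k φ.smooth.continuousOn (fun x hx => (hc x hx).1)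
    (G.memLp_coord g r)

theorem integrable_trace {k : G.I} (φ : G.TestFunction k) (p : G.InterfaceOf k)
    (t : G.L2Vec p.1.1) (r : Fin n) :
    Integrable (fun y => φ.trace p y * t y r) (G.vol p.1.1) := by
  obtain ⟨c, hc⟩ := φ.bounded_trace p
  exact G.integrable_mul_of_bounded p.1.1 (φ.continuousOn_trace p) hc (G.memLp_coord t r)

theorem HasDivTrace.add {k : G.I} {τ τ' : G.L2Mat k} {g g' : G.L2Vec k}
    {t t' : ∀ p : G.InterfaceOf k, G.L2Vec p.1.1} (h : G.HasDivTrace k τ g t)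
    (h' : G.HasDivTrace k τ' g' t') : G.HasDivTrace k (τ + τ') (g + g') (t + t') := by
  intro φ r
  have e1 : ∫ x, ((∑ l, fderiv ℝ φ.toFun x (EuclideanSpace.single l 1) * (τ + τ') x (r, l)) +
      φ.toFun x * (g + g') x r) ∂(G.vol k) =
      ∫ x, (((∑ l, fderiv ℝ φ.toFun x (EuclideanSpace.single l 1) * τ x (r, l)) +
        φ.toFun x * g x r) +
      ((∑ l, fderiv ℝ φ.toFun x (EuclideanSpace.single l 1) * τ' x (r, l)) +
        φ.toFun x * g' x r)) ∂(G.vol k) := by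
    refine integral_congr_ae ?_
    filter_upwards [Lp.coeFn_add τ τ', Lp.coeFn_add g g'] with x hx hx'
    rw [hx, hx']
    simp only [Pi.add_apply, PiLp.add_apply, mul_add, Finset.sum_add_distrib]
    ring
  have e2 : ∀ p, ∫ y, φ.trace p y * (t + t') p y r ∂(G.vol p.1.1) =
      ∫ y, φ.trace p y * t p y r ∂(G.vol p.1.1) +
        ∫ y, φ.trace p y * t' p y r ∂(G.vol p.1.1) := by
    intro p
    rw [← integral_add (G.integrable_trace φ p (t p) r) (G.integrable_trace φ p (t' p) r)]
    refine integral_congr_ae ?_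
    filter_upwards [Lp.coeFn_add (t p) (t' p)] with y hy
    rw [Pi.add_apply, hy, Pi.add_apply, PiLp.add_apply, mul_add]
  rw [e1, integral_add, h φ, h' φ, ← Finset.sum_add_distrib]
  · exact Finset.sum_congr rfl fun p _ => (e2 p).symm
  · exact (integrable_finsetSum _ fun l _ => G.integrable_grad φ τ r l).add
      (G.integrable_fun φ g r)
  · exact (integrable_finsetSum _ fun l _ => G.integrable_grad φ τ' r l).add
      (G.integrable_fun φ g' r)

theorem HasDivTrace.smul {k : G.I} {τ : G.L2Mat k} {g : G.L2Vec k}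
    {t : ∀ p : G.InterfaceOf k, G.L2Vec p.1.1} (a : ℝ) (h : G.HasDivTrace k τ g t) :
    G.HasDivTrace k (a • τ) (a • g) (a • t) := by
  intro φ r
  have e1 : ∫ x, ((∑ l, fderiv ℝ φ.toFun x (EuclideanSpace.single l 1) * (a • τ) x (r, l)) +
      φ.toFun x * (a • g) x r) ∂(G.vol k) =
      ∫ x, a * ((∑ l, fderiv ℝ φ.toFun x (EuclideanSpace.single l 1) * τ x (r, l)) +
        φ.toFun x * g x r) ∂(G.vol k) := by
    refine integral_congr_ae ?_
    filter_upwards [Lp.coeFn_smul a τ, Lp.coeFn_smul a g] with x hx hx'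
    rw [hx, hx']
    simp only [Pi.smul_apply, PiLp.smul_apply, smul_eq_mul, mul_add, Finset.mul_sum,
      mul_left_comm a]
  have e2 : ∀ p, ∫ y, φ.trace p y * (a • t) p y r ∂(G.vol p.1.1) =
      a * ∫ y, φ.trace p y * t p y r ∂(G.vol p.1.1) := by
    intro p
    rw [← integral_const_mul]
    refine integral_congr_ae ?_
    filter_upwards [Lp.coeFn_smul a (t p)] with y hy
    rw [Pi.smul_apply, hy, Pi.smul_apply, PiLp.smul_apply, smul_eq_mul, mul_left_comm]
  rw [e1, integral_const_mul, h φ, Finset.mul_sum]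
  exact Finset.sum_congr rfl fun p _ => (e2 p).symm

theorem HasDivTrace.zero (k : G.I) : G.HasDivTrace k 0 0 0 := by
  intro φ r
  have e1 : ∫ x, ((∑ l, fderiv ℝ φ.toFun x (EuclideanSpace.single l 1) *
      (0 : G.L2Mat k) x (r, l)) + φ.toFun x * (0 : G.L2Vec k) x r) ∂(G.vol k) =
      ∫ _, (0 : ℝ) ∂(G.vol k) := by
    refine integral_congr_ae ?_
    filter_upwards [Lp.coeFn_zero (G.StressVal k) 2 (G.vol k),
      Lp.coeFn_zero (Euc n) 2 (G.vol k)] with x hx hx'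
    rw [hx, hx']
    simp
  have e2 : ∀ p : G.InterfaceOf k,
      ∫ y, φ.trace p y * (0 : G.L2Vec p.1.1) y r ∂(G.vol p.1.1) = 0 := by
    intro p
    rw [← integral_zero (Euc (G.dim p.1.1)) ℝ (μ := G.vol p.1.1)]
    refine integral_congr_ae ?_
    filter_upwards [Lp.coeFn_zero (Euc n) 2 (G.vol p.1.1)] with y hy
    rw [hy]
    simp
  rw [e1, integral_zero]
  exact (Finset.sum_eq_zero fun p _ => e2 p).symm

theorem disjoint_hi (i : G.I) (j : G.J i) : i ≠ G.hi i j := by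
  intro h
  have := G.dim_hi i j
  rw [← h] at this
  omega

theorem chart_notMem {k : G.I} (p : G.InterfaceOf k) {y : Euc (G.dim p.1.1)}
    (hy : y ∈ G.dom p.1.1) {z : Euc (G.dim k)} (hz : z ∈ G.dom k) :
    G.chart k z ≠ G.chart p.1.1 y := by
  intro h
  have hne : p.1.1 ≠ k := by
    have := G.disjoint_hi p.1.1 p.1.2
    rwa [p.2] at this
  exact Set.disjoint_left.1 (G.disjoint_image _ _ hne) (Set.mem_image_of_mem _ hy)
    (h ▸ Set.mem_image_of_mem _ hz)

/-- A smooth function with compact support in `Ω k` is a test function with zero traces. -/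
noncomputable def interiorTest (k : G.I) (ψ : Euc (G.dim k) → ℝ) (hs : ContDiff ℝ ∞ ψ)
    (hc : HasCompactSupport ψ) (hd : tsupport ψ ⊆ G.dom k) : G.TestFunction k where
  toFun := ψ
  smooth := hs.contDiffOn
  bounded := by
    obtain ⟨c, h⟩ := hc.exists_bound_of_continuous hs.continuous
    obtain ⟨c', h'⟩ := (hc.fderiv ℝ).exists_bound_of_continuous (hs.continuous_fderiv (by simp))
    exact ⟨max c c', fun x _ => ⟨(h x).trans (le_max_left _ _), (h' x).trans (le_max_right _ _)⟩⟩
  vanish := by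
    refine ⟨(tsupport ψ)ᶜ, (isClosed_tsupport ψ).isOpen_compl, fun x hx hx' => ?_,
      fun x hx => image_eq_zero_of_notMem_tsupport hx.2⟩
    exact (disjoint_interior_frontier (s := G.dom k)).ne_of_mem
      ((G.isOpen_dom k).interior_eq.symm ▸ hd hx') hx.1 rfl
  trace := fun _ _ => 0
  tendsto_trace := by
    intro p y hy
    refine tendsto_const_nhds.congr' ?_
    have hK : IsClosed (G.chart k '' tsupport ψ) :=
      (hc.isCompact.image (G.chart k).continuous).isClosed
    have hm : (G.chart k '' tsupport ψ)ᶜ ∈ 𝓝 (G.chart p.1.1 y) := by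
      refine hK.isOpen_compl.mem_nhds ?_
      rintro ⟨z, hz, h⟩
      exact G.chart_notMem p hy (hd hz) h
    filter_upwards [preimage_mem_comap (mem_nhdsWithin_of_mem_nhds hm)] with z hz
    exact (image_eq_zero_of_notMem_tsupport fun h => hz (Set.mem_image_of_mem _ h)).symm
  continuousOn_trace := fun _ => continuousOn_const
  bounded_trace := fun _ => ⟨0, by simp⟩

theorem HasDivTrace.div_eq_zero {k : G.I} {g : G.L2Vec k}
    {t : ∀ p : G.InterfaceOf k, G.L2Vec p.1.1} (h : G.HasDivTrace k 0 g t) : g = 0 := by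
  have := G.isFiniteMeasure_vol k
  have key : ∀ r : Fin n, ∀ᵐ x ∂(G.vol k), g x r = 0 := by
    intro r
    refine (ae_restrict_iff' (G.isOpen_dom k).measurableSet).2 ?_
    refine (G.isOpen_dom k).ae_eq_zero_of_integral_contDiff_smul_eq_zero
      (f := fun x => g x r) ?_ ?_
    · have : IntegrableOn (fun x => g x r) (G.dom k) volume :=
        (G.memLp_coord g r).integrable one_le_two
      exact this.locallyIntegrableOn
    · intro ψ hs hc hd
      have h1 := h (G.interiorTest k ψ hs hc hd) r
      have e : ∫ x, ((∑ l, fderiv ℝ ψ x (EuclideanSpace.single l 1) *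
          (0 : G.L2Mat k) x (r, l)) + ψ x * g x r) ∂(G.vol k) = ∫ x, ψ x * g x r ∂(G.vol k) := by
        refine integral_congr_ae ?_
        filter_upwards [Lp.coeFn_zero (G.StressVal k) 2 (G.vol k)] with x hx
        rw [hx]
        simp
      have h2 : ∫ x, ψ x * g x r ∂(G.vol k) = 0 := by
        rw [← e]
        refine h1.trans ?_
        simp [interiorTest]
      rw [← h2]
      refine (setIntegral_eq_integral_of_forall_compl_eq_zero fun x hx => ?_).symm
      rw [image_eq_zero_of_notMem_tsupport fun hx' => hx (hd hx'), zero_smul]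
  refine Lp.ext ?_
  filter_upwards [ae_all_iff.2 key, Lp.coeFn_zero (Euc n) 2 (G.vol k)] with x hx hx'
  rw [hx']
  ext r
  simpa using hx r

end MixedDimGeometry

/-- The foot point on the plane `f`, in parameters. -/
noncomputable def footPoint {n d : ℕ} (f : Euc d →ᵃⁱ[ℝ] Euc n) (y : Euc d) (x : Euc n) : Euc d :=
  ContinuousLinearMap.adjoint f.linearIsometry.toContinuousLinearMap (x - f y) + y

theorem footPoint_apply {n d : ℕ} (f : Euc d →ᵃⁱ[ℝ] Euc n) (y a : Euc d) :
    footPoint f y (f a) = a := by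
  have h : f a - f y = f.linearIsometry (a - y) := by
    have := f.map_vsub a y
    simpa using this.symm
  rw [footPoint, h]
  have : ContinuousLinearMap.adjoint f.linearIsometry.toContinuousLinearMap
      (f.linearIsometry (a - y)) = a - y := by
    refine ext_inner_right ℝ fun v => ?_
    rw [ContinuousLinearMap.adjoint_inner_left]
    exact f.linearIsometry.inner_map_map _ _
  rw [this]
  abel

theorem exists_normal_coord {n d : ℕ} {e : ℕ} {f : Euc d →ᵃⁱ[ℝ] Euc n}
    {g : Euc e →ᵃⁱ[ℝ] Euc n} {O : Set (Euc e)} {ν : Euc n} {y : Euc d}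
    (h : IsSideNormal f g O ν y) (he : e = d + 1) (w : Euc e) :
    ∃ (v : Euc d) (s : ℝ), g.linearIsometry w = f.linearIsometry v + s • ν := by
  obtain ⟨hr, hν, ⟨u, hu⟩, ho, -⟩ := h
  have hν0 : ν ≠ 0 := by
    intro h0
    simp [h0] at hν
  have hle : LinearMap.range f.linearIsometry.toLinearMap ⊔ Submodule.span ℝ {ν} ≤
      LinearMap.range g.linearIsometry.toLinearMap := by
    refine sup_le ?_ ((Submodule.span_singleton_le_iff_mem _ _).2 ⟨u, hu⟩)
    rintro _ ⟨v, rfl⟩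
    obtain ⟨z1, h1⟩ := hr ⟨v, rfl⟩
    obtain ⟨z0, h0⟩ := hr ⟨0, rfl⟩
    refine ⟨z1 - z0, ?_⟩
    have e1 := g.map_vsub z1 z0
    have e2 := f.map_vsub v 0
    simp only [vsub_eq_sub, sub_zero] at e1 e2
    show g.linearIsometry (z1 - z0) = f.linearIsometry v
    rw [e1, e2, h1, h0]
  have hd : Disjoint (LinearMap.range f.linearIsometry.toLinearMap) (Submodule.span ℝ {ν}) := by
    rw [Submodule.disjoint_span_singleton' hν0]
    rintro ⟨v, hv⟩
    have := ho v
    rw [show f.linearIsometry v = ν from hv, real_inner_self_eq_norm_sq, hν] at this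
    norm_num at this
  have hfr : Module.finrank ℝ
      ↥(LinearMap.range f.linearIsometry.toLinearMap ⊔ Submodule.span ℝ {ν}) =
      Module.finrank ℝ ↥(LinearMap.range g.linearIsometry.toLinearMap) := by
    have h1 := Submodule.finrank_sup_add_finrank_inf_eq
      (LinearMap.range f.linearIsometry.toLinearMap) (Submodule.span ℝ {ν})
    rw [hd.eq_bot, finrank_bot, finrank_span_singleton hν0,
      LinearMap.finrank_range_of_inj f.linearIsometry.injective, finrank_euclideanSpace_fin] at h1
    rw [LinearMap.finrank_range_of_inj g.linearIsometry.injective, finrank_euclideanSpace_fin]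
    omega
  have heq := Submodule.eq_of_le_of_finrank_eq hle hfr
  have hw : g.linearIsometry w ∈
      LinearMap.range f.linearIsometry.toLinearMap ⊔ Submodule.span ℝ {ν} := by
    rw [heq]
    exact ⟨w, rfl⟩
  obtain ⟨_, ⟨v, rfl⟩, _, hs, hvs⟩ := Submodule.mem_sup.1 hw
  obtain ⟨s, rfl⟩ := Submodule.mem_span_singleton.1 hs
  exact ⟨v, s, hvs.symm⟩

theorem foot_add_normal {n d : ℕ} {e : ℕ} {f : Euc d →ᵃⁱ[ℝ] Euc n}
    {g : Euc e →ᵃⁱ[ℝ] Euc n} {O : Set (Euc e)} {ν : Euc n} {y : Euc d}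
    (h : IsSideNormal f g O ν y) (he : e = d + 1) (z : Euc e) :
    g z = f (footPoint f y (g z)) + ⟪g z - f y, ν⟫_ℝ • ν := by
  obtain ⟨z0, h0⟩ := h.1 ⟨y, rfl⟩
  obtain ⟨v, s, hvs⟩ := exists_normal_coord h he (z - z0)
  obtain ⟨-, hν, -, ho, -⟩ := h
  have e1 := g.map_vsub z z0
  have e2 := f.map_vsub (v + y) y
  simp only [vsub_eq_sub, add_sub_cancel_right] at e1 e2
  have hz : g z - f y = f.linearIsometry v + s • ν := by
    rw [← hvs, e1, h0]
  have hs : ⟪g z - f y, ν⟫_ℝ = s := by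
    rw [hz, inner_add_left, real_inner_smul_left, real_inner_self_eq_norm_sq, hν,
      real_inner_comm, ho]
    simp
  have hf : footPoint f y (g z) = v + y := by
    rw [footPoint, hz]
    congr 1
    refine ext_inner_right ℝ fun u => ?_
    rw [ContinuousLinearMap.adjoint_inner_left, inner_add_left, real_inner_smul_left]
    have h1 : ⟪ν, f.linearIsometry.toContinuousLinearMap u⟫_ℝ = 0 := ho u
    rw [h1, mul_zero, add_zero]
    exact f.linearIsometry.inner_map_map _ _
  rw [hs, hf, show f (v + y) = f.linearIsometry v + f y by rw [e2]; abel]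
  rw [sub_eq_iff_eq_add.1 hz]
  abel

/-- A bump function in foot point and normal coordinates, in the ambient space. -/
noncomputable def ambientBump {n d : ℕ} (f : Euc d →ᵃⁱ[ℝ] Euc n) (ν : Euc n) (y : Euc d)
    (η : Euc d → ℝ) (χ : ContDiffBump (0 : ℝ)) (x : Euc n) : ℝ :=
  η (footPoint f y x) * χ ⟪x - f y, ν⟫_ℝ

theorem contDiff_footPoint {n d : ℕ} (f : Euc d →ᵃⁱ[ℝ] Euc n) (y : Euc d) :
    ContDiff ℝ ∞ (footPoint f y) := by
  unfold footPoint
  fun_prop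

theorem contDiff_ambientBump {n d : ℕ} (f : Euc d →ᵃⁱ[ℝ] Euc n) (ν : Euc n) (y : Euc d)
    {η : Euc d → ℝ} (hη : ContDiff ℝ ∞ η) (χ : ContDiffBump (0 : ℝ)) :
    ContDiff ℝ ∞ (ambientBump f ν y η χ) := by
  unfold ambientBump
  refine (hη.comp (contDiff_footPoint f y)).mul (χ.contDiff.comp ?_)
  exact (contDiff_id.sub contDiff_const).inner ℝ contDiff_const

namespace MixedDimGeometry

variable {n : ℕ} (G : MixedDimGeometry n)

open Classical in
/-- A test function with prescribed trace on one interface, locally, and zero traces on the others. -/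
theorem exists_interfaceTest (i : G.I) (j : G.J i) {y₀ : Euc (G.dim i)} (hy₀ : y₀ ∈ G.dom i) :
    ∃ R > 0, ∀ η : Euc (G.dim i) → ℝ, ContDiff ℝ ∞ η → HasCompactSupport η →
      tsupport η ⊆ G.dom i ∩ Metric.ball y₀ R → ∃ φ : G.TestFunction (G.hi i j),
        φ.trace ⟨⟨i, j⟩, rfl⟩ = η ∧
        ∀ q : G.InterfaceOf (G.hi i j), q ≠ ⟨⟨i, j⟩, rfl⟩ → φ.trace q = 0 := by
  have hside := G.isSideNormal i j y₀ hy₀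
  have hdim := G.dim_hi i j
  obtain ⟨-, hν, hνg, ho, r, hr, hball⟩ := id hside
  set f := G.chart i with hf
  set g := G.chart (G.hi i j) with hg
  set ν := G.normal i j with hνdef
  have decomp := fun z => foot_add_normal (hside) hdim z
  refine ⟨r / 2, half_pos hr, fun η hη hηc hηs => ?_⟩
  let χ : ContDiffBump (0 : ℝ) := ⟨r / 8, r / 4, by positivity, by linarith⟩
  set F := ambientBump f ν y₀ η χ with hF
  have hFs : ContDiff ℝ ∞ F := contDiff_ambientBump f ν y₀ hη χ
  -- the coordinates
  set A : Euc n → Euc (G.dim i) := footPoint f y₀ with hA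
  set S : Euc n → ℝ := fun x => ⟪x - f y₀, ν⟫_ℝ with hS
  have hAc : Continuous A := (contDiff_footPoint f y₀).continuous
  have hSc : Continuous S := by
    rw [hS]
    fun_prop
  have hSf : ∀ y : Euc (G.dim i), ∀ x, ⟪x - f y, ν⟫_ℝ = S x := by
    intro y x
    have e : x - f y₀ = (x - f y) + f.linearIsometry (y - y₀) := by
      have := f.map_vsub y y₀
      simp only [vsub_eq_sub] at this
      rw [this]
      abel
    simp only [hS]
    rw [e, inner_add_left, real_inner_comm ν (f.linearIsometry _), ho, add_zero]
  -- the set that carries the bump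
  let K : Set (Euc n) := {x | A x ∈ tsupport η ∧ |S x| ≤ r / 4}
  have hKc : IsClosed K :=
    ((isClosed_tsupport η).preimage hAc).inter (isClosed_le hSc.abs continuous_const)
  have hFK : ∀ x, x ∉ K → F x = 0 := by
    intro x hx
    by_cases h1 : A x ∈ tsupport η
    · have h2 : r / 4 < |S x| := by
        by_contra h2
        exact hx ⟨h1, not_lt.1 h2⟩
      have : χ (S x) = 0 := χ.zero_of_le_dist (by simpa using h2.le)
      show η (A x) * χ (S x) = 0
      rw [this, mul_zero]
    · show η (A x) * χ (S x) = 0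
      rw [image_eq_zero_of_notMem_tsupport h1, zero_mul]
  have hKball : ∀ z, g z ∈ K → dist (g z) (f y₀) < r := by
    rintro z ⟨h1, h2⟩
    rw [decomp z]
    calc dist (f (A (g z)) + S (g z) • ν) (f y₀)
        ≤ dist (f (A (g z)) + S (g z) • ν) (f (A (g z))) + dist (f (A (g z))) (f y₀) :=
          dist_triangle _ _ _
      _ = |S (g z)| + dist (A (g z)) y₀ := by
          rw [dist_eq_norm, add_sub_cancel_left, norm_smul, hν, mul_one, f.dist_map,
            Real.norm_eq_abs]
      _ < r := by
          have := (hηs h1).2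
          rw [Metric.mem_ball] at this
          linarith
  have hKdom : ∀ z, g z ∈ K → S (g z) < 0 → z ∈ G.dom (G.hi i j) := fun z hz hs =>
    hball z (hKball z hz) hs
  have hKzero : ∀ z, g z ∈ K → S (g z) = 0 → g z = f (A (g z)) ∧ A (g z) ∈ G.dom i := by
    intro z hz hs
    refine ⟨?_, (hηs hz.1).1⟩
    have := decomp z
    rw [show ⟪g z - f y₀, ν⟫_ℝ = 0 from hs, zero_smul, add_zero] at this
    exact this
  -- the test function
  let φ : Euc (G.dim (G.hi i j)) → ℝ := fun z => if S (g z) < 0 then F (g z) else 0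
  have hgs : ContDiff ℝ ∞ g := by
    have := g.toContinuousAffineMap.contDiff (n := ∞)
    exact this
  have hgc := hgs.continuous
  -- locally on the domain it is the bump or zero
  have hloc : ∀ z ∈ G.dom (G.hi i j), φ =ᶠ[𝓝 z] (F ∘ g) ∨ φ =ᶠ[𝓝 z] fun _ => 0 := by
    intro z hz
    rcases lt_trichotomy (S (g z)) 0 with h | h | h
    · left
      filter_upwards [(hSc.comp hgc).continuousAt.eventually_lt continuousAt_const h] with x hx
      exact if_pos hx
    · right
      have hzK : g z ∉ K := by
        intro hzK
        obtain ⟨h1, h2⟩ := hKzero z hzK h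
        exact G.chart_notMem (⟨⟨i, j⟩, rfl⟩ : G.InterfaceOf (G.hi i j)) h2 hz h1
      filter_upwards [hgc.continuousAt.preimage_mem_nhds (hKc.isOpen_compl.mem_nhds hzK)] with x hx
      show (if _ then F (g x) else 0) = 0
      rw [hFK _ hx, ite_self]
    · right
      filter_upwards [continuousAt_const.eventually_lt (hSc.comp hgc).continuousAt h] with x hx
      exact if_neg (not_lt.2 (le_of_lt hx))
  have hcomp : HasCompactSupport (F ∘ g) := by
    obtain ⟨z₀, hz₀⟩ := hside.1 ⟨y₀, rfl⟩
    refine HasCompactSupport.intro (isCompact_closedBall z₀ r) fun z hz => hFK _ fun hK => hz ?_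
    have := hKball z hK
    rw [← hz₀, g.dist_map] at this
    exact this.le
  let T : ∀ q : G.InterfaceOf (G.hi i j), Euc (G.dim q.1.1) → ℝ := fun q =>
    if h : q = ⟨⟨i, j⟩, rfl⟩ then h ▸ η else 0
  have hT1 : T ⟨⟨i, j⟩, rfl⟩ = η := dif_pos rfl
  have hT0 : ∀ q, q ≠ ⟨⟨i, j⟩, rfl⟩ → T q = 0 := fun q hq => dif_neg hq
  refine ⟨⟨φ, ?_, ?_, ?_, T, ?_, ?_, ?_⟩, hT1, hT0⟩
  · intro z hz
    rcases hloc z hz with h | h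
    · exact ((hFs.comp hgs).contDiffAt.congr_of_eventuallyEq h).contDiffWithinAt
    · exact (contDiffAt_const.congr_of_eventuallyEq h).contDiffWithinAt
  · obtain ⟨c, hc⟩ := hcomp.exists_bound_of_continuous (hFs.comp hgs).continuous
    obtain ⟨c', hc'⟩ := (hcomp.fderiv ℝ).exists_bound_of_continuous
      ((hFs.comp hgs).continuous_fderiv (by simp))
    refine ⟨max c c', fun z hz => ?_⟩
    rcases hloc z hz with h | h
    · rw [h.eq_of_nhds, h.fderiv_eq]
      exact ⟨(hc z).trans (le_max_left _ _), (hc' z).trans (le_max_right _ _)⟩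
    · rw [h.eq_of_nhds, h.fderiv_eq]
      have := (norm_nonneg _).trans (hc z)
      simp [this]
  · refine ⟨{z | g z ∈ K ∧ S (g z) ≤ 0}ᶜ, ?_, ?_, ?_⟩
    · exact ((hKc.preimage hgc).inter
        (isClosed_le (hSc.comp hgc) continuous_const)).isOpen_compl
    · rintro z ⟨hz1, hz2⟩ ⟨hzK, hzS⟩
      rcases hzS.lt_or_eq with h | h
      · exact (disjoint_interior_frontier (s := G.dom (G.hi i j))).ne_of_mem
          ((G.isOpen_dom (G.hi i j)).interior_eq.symm ▸ hKdom z hzK h) hz1 rfl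
      · obtain ⟨h1, h2⟩ := hKzero z hzK h
        have hY : g z ∈ G.Y := by
          rw [h1]
          exact G.image_subset i (Set.mem_image_of_mem _ h2)
        exact (disjoint_interior_frontier (s := G.Y)).ne_of_mem
          (G.isOpen_Y.interior_eq.symm ▸ hY) (G.boundaryU_subset hz2) rfl
    · rintro z ⟨-, hz⟩
      show (if S (g z) < 0 then F (g z) else 0) = 0
      split_ifs with h
      · exact hFK _ fun hK => hz ⟨hK, h.le⟩
      · rfl
  · intro q y hy
    by_cases hq : q = ⟨⟨i, j⟩, rfl⟩
    · subst hq
      rw [hT1]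
      have e : η y = F (f y) := by
        show η y = η (A (f y)) * χ (S (f y))
        have h1 : A (f y) = y := footPoint_apply f y₀ y
        have h2 : S (f y) = 0 := by
          rw [← hSf y, sub_self, inner_zero_left]
        rw [h1, h2, χ.one_of_mem_closedBall (Metric.mem_closedBall_self χ.rIn_pos.le), mul_one]
      rw [e]
      have h1 : Tendsto (F ∘ g) (comap g (𝓝[{x | ⟪x - f y, ν⟫_ℝ < 0}] (f y))) (𝓝 (F (f y))) :=
        (hFs.continuous.continuousAt.tendsto.mono_left nhdsWithin_le_nhds).comp tendsto_comap
      refine h1.congr' ?_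
      filter_upwards [preimage_mem_comap (self_mem_nhdsWithin)] with z hz
      have : S (g z) < 0 := by
        rw [← hSf y]
        exact hz
      exact (if_pos this).symm
    · rw [hT0 q hq]
      refine tendsto_const_nhds.congr' ?_
      by_cases hcK : G.chart q.1.1 y ∈ K
      swap
      · filter_upwards [preimage_mem_comap
          (mem_nhdsWithin_of_mem_nhds (hKc.isOpen_compl.mem_nhds hcK))] with z hz
        show 0 = if S (g z) < 0 then F (g z) else 0
        rw [hFK _ hz, ite_self]
      have hrange : ∃ zc, g zc = G.chart q.1.1 y := by
        have h := (G.isSideNormal q.1.1 q.1.2 y hy).1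
        rw [q.2] at h
        exact h ⟨y, rfl⟩
      obtain ⟨zc, hzc⟩ := hrange
      rcases lt_trichotomy (S (G.chart q.1.1 y)) 0 with h | h | h
      · rw [← hzc] at h hcK
        exact absurd hzc (G.chart_notMem q hy (hKdom zc hcK h))
      · rw [← hzc] at h hcK
        obtain ⟨h1, h2⟩ := hKzero zc hcK h
        obtain ⟨⟨i', j'⟩, hij⟩ := q
        dsimp only at hy hzc hij
        have hii : i' = i := by
          by_contra hne
          refine Set.disjoint_left.1 (G.disjoint_image _ _ hne) (Set.mem_image_of_mem _ hy) ?_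
          rw [← hzc, h1]
          exact Set.mem_image_of_mem _ h2
        subst hii
        have hjj : G.normal i' j' ≠ ν := fun he => hq (by
          have := G.side_injective i' j' j hij he
          subst this
          rfl)
        obtain ⟨-, hν', hw', ho', -⟩ := G.isSideNormal i' j' y hy
        rw [hij] at hw'
        obtain ⟨w', hw'⟩ := hw'
        obtain ⟨v, s, hvs⟩ := exists_normal_coord hside hdim w'
        have hvs' : G.normal i' j' = f.linearIsometry v + s • ν := hw'.symm.trans hvs
        have hv : ‖f.linearIsometry v‖ ^ 2 = 0 := by
          have h3 := ho' v
          rw [hvs', inner_add_left, real_inner_smul_left] at h3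
          have h4 : ⟪ν, (G.chart i').linearIsometry v⟫_ℝ = 0 := ho v
          rw [h4, mul_zero, add_zero] at h3
          rw [← real_inner_self_eq_norm_sq]
          exact h3
        have hv0 : f.linearIsometry v = 0 := norm_eq_zero.1 (pow_eq_zero_iff two_ne_zero |>.1 hv)
        rw [hv0, zero_add] at hvs'
        rw [hvs', norm_smul, hν, mul_one, Real.norm_eq_abs] at hν'
        have hs : s = -1 := by
          rcases (abs_eq zero_le_one).1 hν' with h3 | h3
          · exact absurd (by rw [hvs', h3, one_smul]) hjj
          · exact h3
        filter_upwards [preimage_mem_comap (self_mem_nhdsWithin)] with z hz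
        have h5 : ⟪g z - f y, G.normal i' j'⟫_ℝ < 0 := hz
        rw [hvs', hs, real_inner_smul_right, hSf y] at h5
        exact (if_neg (by linarith)).symm
      · filter_upwards [preimage_mem_comap (mem_nhdsWithin_of_mem_nhds
          ((isOpen_lt continuous_const hSc).mem_nhds h))] with z hz
        exact (if_neg (not_lt.2 (le_of_lt hz))).symm
  · intro q
    by_cases hq : q = ⟨⟨i, j⟩, rfl⟩
    · subst hq
      rw [hT1]
      exact hη.continuous.continuousOn
    · rw [hT0 q hq]
      exact continuousOn_const
  · intro q
    by_cases hq : q = ⟨⟨i, j⟩, rfl⟩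
    · subst hq
      rw [hT1]
      obtain ⟨c, hc⟩ := hηc.exists_bound_of_continuous hη.continuous
      exact ⟨c, fun y _ => hc y⟩
    · rw [hT0 q hq]
      exact ⟨0, by simp⟩

end MixedDimGeometry

namespace MixedDimGeometry

variable {n : ℕ} (G : MixedDimGeometry n)

theorem HasDivTrace.trace_eq_zero {k : G.I} {t : ∀ p : G.InterfaceOf k, G.L2Vec p.1.1}
    (h : G.HasDivTrace k 0 0 t) : t = 0 := by
  funext p
  obtain ⟨⟨i, j⟩, rfl⟩ := p
  have := G.isFiniteMeasure_vol i
  set p : G.InterfaceOf (G.hi i j) := ⟨⟨i, j⟩, rfl⟩ with hp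
  have hint : ∀ (φ : G.TestFunction (G.hi i j)) (r : Fin n),
      ∑ q : G.InterfaceOf (G.hi i j), ∫ y, φ.trace q y * t q y r ∂(G.vol q.1.1) = 0 := by
    intro φ r
    rw [← h φ r]
    have e : ∫ x, ((∑ l, fderiv ℝ φ.toFun x (EuclideanSpace.single l 1) *
        (0 : G.L2Mat (G.hi i j)) x (r, l)) + φ.toFun x * (0 : G.L2Vec (G.hi i j)) x r)
          ∂(G.vol (G.hi i j)) = ∫ _, (0 : ℝ) ∂(G.vol (G.hi i j)) := by
      refine integral_congr_ae ?_
      filter_upwards [Lp.coeFn_zero (G.StressVal (G.hi i j)) 2 (G.vol (G.hi i j)),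
        Lp.coeFn_zero (Euc n) 2 (G.vol (G.hi i j))] with x hx hx'
      rw [hx, hx']
      simp
    rw [e, integral_zero]
  have key : ∀ r : Fin n, ∀ᵐ y ∂(G.vol i), t p y r = 0 := by
    intro r
    refine (ae_restrict_iff' (G.isOpen_dom i).measurableSet).2 ?_
    have hloc : ∀ y₀ ∈ G.dom i, ∃ u ∈ 𝓝[G.dom i] y₀,
        ∀ᵐ y ∂(volume : Measure (Euc (G.dim i))), y ∈ u → t p y r = 0 := by
      intro y₀ hy₀
      obtain ⟨R, hR, hφ⟩ := G.exists_interfaceTest i j hy₀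
      have hU : IsOpen (G.dom i ∩ Metric.ball y₀ R) := (G.isOpen_dom i).inter Metric.isOpen_ball
      refine ⟨G.dom i ∩ Metric.ball y₀ R, mem_nhdsWithin_of_mem_nhds
        (hU.mem_nhds ⟨hy₀, Metric.mem_ball_self hR⟩), ?_⟩
      refine hU.ae_eq_zero_of_integral_contDiff_smul_eq_zero (f := fun y => t p y r) ?_ ?_
      · have : IntegrableOn (fun y => t p y r) (G.dom i) volume :=
          (G.memLp_coord (t p) r).integrable one_le_two
        exact (this.mono_set Set.inter_subset_left).locallyIntegrableOn
      · intro η hη hηc hηs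
        obtain ⟨φ, h1, h2⟩ := hφ η hη hηc hηs
        have h3 := hint φ r
        rw [Finset.sum_eq_single p] at h3
        · rw [h1] at h3
          rw [← h3]
          refine (setIntegral_eq_integral_of_forall_compl_eq_zero fun y hy => ?_).symm
          rw [image_eq_zero_of_notMem_tsupport fun hy' => hy (hηs hy').1, zero_smul]
        · intro q _ hq
          rw [h2 q hq]
          simp
        · intro hn
          exact absurd (Finset.mem_univ _) hn
    have hnull : volume {y ∈ G.dom i | t p y r ≠ 0} = 0 := by
      refine measure_null_of_locally_null _ fun y₀ hy₀ => ?_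
      obtain ⟨u, hu, hau⟩ := hloc y₀ hy₀.1
      refine ⟨{y ∈ u | t p y r ≠ 0}, ?_, ?_⟩
      · have h1 : u ∈ 𝓝[{y ∈ G.dom i | t p y r ≠ 0}] y₀ :=
          nhdsWithin_mono _ (fun y hy => hy.1) hu
        filter_upwards [h1, self_mem_nhdsWithin] with y hy hy' using ⟨hy, hy'.2⟩
      · have h1 := ae_iff.1 hau
        simpa only [Classical.not_imp] using h1
    have h1 : ∀ᵐ y ∂(volume : Measure (Euc (G.dim i))), ¬ (y ∈ G.dom i ∧ t p y r ≠ 0) :=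
      measure_eq_zero_iff_ae_notMem.1 hnull
    filter_upwards [h1] with y hy hy'
    by_contra hne
    exact hy ⟨hy', hne⟩
  refine Lp.ext ?_
  filter_upwards [ae_all_iff.2 key, Lp.coeFn_zero (Euc n) 2 (G.vol i)] with y hy hy'
  rw [Pi.zero_apply, hy']
  ext r
  simpa using hy r

/-- The weak divergence and the normal traces are unique. -/
theorem HasDivTrace.unique {k : G.I} {τ : G.L2Mat k} {g g' : G.L2Vec k}
    {t t' : ∀ p : G.InterfaceOf k, G.L2Vec p.1.1} (h : G.HasDivTrace k τ g t)
    (h' : G.HasDivTrace k τ g' t') : g = g' ∧ t = t' := by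
  have h1 := HasDivTrace.add G h (HasDivTrace.smul G (-1) h')
  have h2 : τ + (-1 : ℝ) • τ = 0 := by
    rw [neg_one_smul, add_neg_cancel]
  rw [h2] at h1
  have hg := HasDivTrace.div_eq_zero G h1
  rw [hg] at h1
  have ht := HasDivTrace.trace_eq_zero G h1
  rw [neg_one_smul, add_neg_eq_zero] at hg ht
  exact ⟨hg, ht⟩

/-- The space of stresses on `Ω k`: the fields in `H(div, Ω k)ⁿ` with an `L²` normal trace on the
interfaces on the boundary of `Ω k` and with zero normal trace on the rest of the boundary, except for the part
where the displacement is prescribed. -/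
def Stress (k : G.I) : Submodule ℝ (G.L2Mat k) where
  carrier := {τ | ∃ g t, G.HasDivTrace k τ g t}
  add_mem' := by
    rintro _ _ ⟨g, t, h⟩ ⟨g', t', h'⟩
    exact ⟨_, _, HasDivTrace.add G h h'⟩
  zero_mem' := ⟨_, _, HasDivTrace.zero G k⟩
  smul_mem' := by
    rintro a _ ⟨g, t, h⟩
    exact ⟨_, _, HasDivTrace.smul G a h⟩

/-- The stress space `Σ`. For the points of the geometry the factor is trivial. -/
abbrev StressSpace : Type := ∀ i, G.Stress i

/-- The displacement space `U`. -/
abbrev DispSpace : Type := ∀ i, G.L2Vec i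

/-- The space `R` of the multipliers for the symmetry of the stress. -/
abbrev RotSpace : Type := ∀ i, G.L2Skw i

/-- `L²` fields on `Ω × Γ`: matrix fields on the manifolds and vector fields on the interfaces. -/
abbrev BulkInterface : Type := (∀ i, G.L2Mat i) × (∀ i, G.J i → G.L2Vec i)

/-- The divergence and the normal traces of a stress. -/
noncomputable def divTrace (k : G.I) (τ : G.Stress k) :
    G.L2Vec k × (∀ p : G.InterfaceOf k, G.L2Vec p.1.1) :=
  (τ.2.choose, τ.2.choose_spec.choose)

theorem hasDivTrace_divTrace {k : G.I} (τ : G.Stress k) :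
    G.HasDivTrace k τ (G.divTrace k τ).1 (G.divTrace k τ).2 :=
  τ.2.choose_spec.choose_spec

theorem divTrace_eq {k : G.I} {τ : G.Stress k} {g : G.L2Vec k}
    {t : ∀ p : G.InterfaceOf k, G.L2Vec p.1.1} (h : G.HasDivTrace k τ g t) :
    G.divTrace k τ = (g, t) :=
  Prod.ext_iff.2 (HasDivTrace.unique G (G.hasDivTrace_divTrace τ) h)

theorem divTrace_add {k : G.I} (τ τ' : G.Stress k) :
    G.divTrace k (τ + τ') = G.divTrace k τ + G.divTrace k τ' :=
  G.divTrace_eq (HasDivTrace.add G (G.hasDivTrace_divTrace τ) (G.hasDivTrace_divTrace τ'))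

theorem divTrace_smul {k : G.I} (a : ℝ) (τ : G.Stress k) :
    G.divTrace k (a • τ) = a • G.divTrace k τ :=
  G.divTrace_eq (HasDivTrace.smul G a (G.hasDivTrace_divTrace τ))

/-- The row-wise divergence on `Ω i`. -/
noncomputable def div (i : G.I) : G.Stress i →ₗ[ℝ] G.L2Vec i where
  toFun τ := (G.divTrace i τ).1
  map_add' τ τ' := by rw [divTrace_add, Prod.fst_add]
  map_smul' a τ := by rw [divTrace_smul, Prod.smul_fst, RingHom.id_apply]

/-- The normal trace on the interface `j`, of stresses on the higher-dimensional neighbour. -/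
noncomputable def normalTrace (i : G.I) (j : G.J i) : G.Stress (G.hi i j) →ₗ[ℝ] G.L2Vec i where
  toFun τ := (G.divTrace (G.hi i j) τ).2 ⟨⟨i, j⟩, rfl⟩
  map_add' τ τ' := by rw [divTrace_add, Prod.snd_add, Pi.add_apply]
  map_smul' a τ := by rw [divTrace_smul, Prod.smul_snd, Pi.smul_apply, RingHom.id_apply]

/-- The mixed-dimensional divergence: the divergence minus the jump of the normal traces. -/
noncomputable def mdDiv (σ : G.StressSpace) : G.DispSpace :=
  fun i => G.div i (σ i) - ∑ j, G.normalTrace i j (σ (G.hi i j))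

/-- The tangential rows of a stress value, in the basis of the parametrization: the inner products of
the tangential basis vectors with the columns. -/
noncomputable def tangential (i : G.I) :
    G.StressVal i →ₗ[ℝ] Matrix (Fin (G.dim i)) (Fin (G.dim i)) ℝ where
  toFun s := Matrix.of fun r l =>
    ∑ m, (G.chart i).linearIsometry (EuclideanSpace.single r 1) m * s (m, l)
  map_add' s t := by
    ext r l
    simp [mul_add, Finset.sum_add_distrib]
  map_smul' a s := by
    ext r l
    simp [Finset.mul_sum, mul_left_comm]

/-- `skw` of a stress value: `skw` of its tangential rows. -/
noncomputable def skwVal (i : G.I) : G.StressVal i →ₗ[ℝ] Euc ((G.dim i).choose 2) :=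
  skwMat (G.dim i) ∘ₗ G.tangential i

/-- `skw` of a stress field. -/
noncomputable def skw (σ : G.StressSpace) : G.RotSpace :=
  fun i => (LinearMap.toContinuousLinearMap (G.skwVal i)).compLp (σ i : G.L2Mat i)

/-- A stress, seen as the pair of the field itself on `Ω` and of its normal traces on `Γ`. -/
noncomputable def toBulkInterface (σ : G.StressSpace) : G.BulkInterface :=
  (fun i => (σ i : G.L2Mat i), fun i j => G.normalTrace i j (σ (G.hi i j)))

/-- The inner product on `Ω × Γ`. -/
noncomputable def innerBI (f g : G.BulkInterface) : ℝ :=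
  (∑ i, ⟪f.1 i, g.1 i⟫_ℝ) + ∑ i, ∑ j, ⟪f.2 i j, g.2 i j⟫_ℝ

/-- The norm on `Ω × Γ`. -/
noncomputable def normBI (f : G.BulkInterface) : ℝ := √(G.innerBI f f)

/-- A scaling parameter: a positive constant on each manifold, equal to one in the surrounding medium. -/
def IsScaling (ε : G.I → ℝ) : Prop :=
  (∀ i, 0 < ε i) ∧ ∀ i, G.dim i = n → ε i = 1

/-- The largest value of `ε` on the adjacent manifolds of one dimension higher; one in the medium. -/
noncomputable def epsMax (ε : G.I → ℝ) (i : G.I) : ℝ :=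
  if G.dim i = n then 1 else ⨆ j : G.J i, ε (G.hi i j)

/-- Multiplication of stresses by a constant on each manifold. -/
noncomputable def scaleStress (c : G.I → ℝ) (σ : G.StressSpace) : G.StressSpace :=
  fun i => c i • σ i

/-- Multiplication by `ε` on `Ω × Γ`; on an interface, `ε` takes the value of the higher-dimensional
neighbour. -/
noncomputable def scaleBI (ε : G.I → ℝ) (f : G.BulkInterface) : G.BulkInterface :=
  (fun i => ε i • f.1 i, fun i j => ε (G.hi i j) • f.2 i j)

/-- The scaled operator `𝔄 = ε 𝒜 ε⁻¹` of the stress-strain relation `𝒜`. -/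
noncomputable def scaledLaw (ε : G.I → ℝ) (A : G.StressSpace →ₗ[ℝ] G.BulkInterface)
    (σ : G.StressSpace) : G.BulkInterface :=
  G.scaleBI ε (A (G.scaleStress (fun i => (ε i)⁻¹) σ))

/-- The bilinear form `a(σ; τ) = (𝔄 σ, τ)` on `Ω × Γ`. -/
noncomputable def formA (ε : G.I → ℝ) (A : G.StressSpace →ₗ[ℝ] G.BulkInterface)
    (σ τ : G.StressSpace) : ℝ :=
  G.innerBI (G.scaledLaw ε A σ) (G.toBulkInterface τ)

/-- The standing assumption on the material: `𝔄` is continuous with constant `M` and coercive with constant `α`,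
with respect to the `L²` norm on `Ω × Γ`. -/
def IsContinuousCoercive (ε : G.I → ℝ) (A : G.StressSpace →ₗ[ℝ] G.BulkInterface) (M α : ℝ) :
    Prop :=
  (∀ σ τ, G.formA ε A σ τ ≤ M * G.normBI (G.toBulkInterface σ) * G.normBI (G.toBulkInterface τ)) ∧
    ∀ σ, α * G.normBI (G.toBulkInterface σ) ^ 2 ≤ G.formA ε A σ σ

/-- The bilinear form `b(σ; v, s) = (𝔇 · εσ, v) + (skw εσ, s)` on `Ω`. -/
noncomputable def formB (ε : G.I → ℝ) (σ : G.StressSpace) (v : G.DispSpace) (s : G.RotSpace) : ℝ :=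
  (∑ i, ⟪G.mdDiv (G.scaleStress ε σ) i, v i⟫_ℝ) + ∑ i, ⟪G.skw (G.scaleStress ε σ) i, s i⟫_ℝ

/-- The weighted norm on the stress space. -/
noncomputable def stressNorm (ε : G.I → ℝ) (σ : G.StressSpace) : ℝ :=
  √((∑ i, ‖(σ i : G.L2Mat i)‖ ^ 2) + (∑ i, ∑ j, ‖G.normalTrace i j (σ (G.hi i j))‖ ^ 2) +
    ∑ i, ‖(G.epsMax ε i)⁻¹ • G.mdDiv (G.scaleStress ε σ) i‖ ^ 2)

/-- The compatibility condition on the discrete stresses and displacements: on each manifold the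
divergence of a discrete stress is a discrete displacement, and on each interface the normal traces of the discrete
stresses of the higher-dimensional neighbour are exactly the discrete displacements. -/
def DivCompatible (Sh : ∀ i, Submodule ℝ (G.Stress i)) (Uh : ∀ i, Submodule ℝ (G.L2Vec i)) :
    Prop :=
  (∀ i, (Sh i).map (G.div i) ≤ Uh i) ∧
    ∀ i, ∀ j, (Sh (G.hi i j)).map (G.normalTrace i j) = Uh i

end MixedDimGeometry

namespace MixedDimGeometry

variable {n : ℕ} (G : MixedDimGeometry n)

/-! The weighted norm differs from the norm on `Ω × Γ` only by the term with `𝔇 · εσ`, and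
coercivity in the norm on `Ω × Γ` is assumed. So it is enough that `𝔇 · εσ` vanishes on the discrete
kernel of `b`.

A priori, membership in the discrete kernel says only that `𝔇 · εσ` is orthogonal to the discrete
displacements, which leaves room for a nonzero divergence. Compatibility closes this gap:
`mdDiv_scaleStress_mem` shows that `𝔇 · εσ` is itself a discrete displacement, hence an admissible
test function. Testing with it, and with zero rotation, turns the kernel condition into `∑ ‖𝔇 · εσ‖²
= 0`, so the divergence vanishes exactly and not just in a projected sense
(`mdDiv_scaleStress_eq_zero`). Then the two norms agree (`stressNorm_eq_normBI`), and coercivity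
gives the claim with `C = α`. The weight `epsMax` multiplies only a term that is zero, so no
dependence on `ε` can enter; nor do the discrete spaces contribute a constant.

The argument treats `div` and `normalTrace` as linear maps, although they come from a choice of weak
divergence and traces. This rests on `HasDivTrace.unique`: test functions with compact support
determine the divergence, and then one-sided bumps at an interface (`exists_interfaceTest`), with
zero trace on every other interface and on the opposite side, determine the normal traces. -/

/-- Under the compatibility condition, the mixed-dimensional divergence of a scaled discrete stress is a
discrete displacement. -/
theorem mdDiv_scaleStress_mem {Sh : ∀ i, Submodule ℝ (G.Stress i)}
    {Uh : ∀ i, Submodule ℝ (G.L2Vec i)} (h : G.DivCompatible Sh Uh) (ε : G.I → ℝ)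
    {σ : G.StressSpace} (hσ : ∀ i, σ i ∈ Sh i) (i : G.I) :
    G.mdDiv (G.scaleStress ε σ) i ∈ Uh i := by
  -- Since `ε` is constant on each manifold, scaling acts on each factor as multiplication by a real
  -- number, and a linear subspace is stable under it. A variable weight could lead out of the
  -- discrete space.
  have hs : ∀ k, G.scaleStress ε σ k ∈ Sh k := fun k => (Sh k).smul_mem _ (hσ k)
  -- By definition `mdDiv` is a divergence on `Ω i` minus a sum of traces from the neighbours `hi i
  -- j`. The two halves of compatibility place these terms, which come from different factors of the
  -- stress space, in the same space `Uh i`. For `dim i = n` there are no sides and the sum is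
  -- empty.
  refine (Uh i).sub_mem (h.1 i (Submodule.mem_map_of_mem (hs i)))
    ((Uh i).sum_mem fun j _ => ?_)
  -- `Uh i` is replaced by the image of the discrete stresses of the neighbour under the normal
  -- trace, where membership is evident.
  rw [← h.2 i j]
  exact Submodule.mem_map_of_mem (hs _)

/-- A discrete stress in the kernel of `b` has vanishing mixed-dimensional divergence. -/
theorem mdDiv_scaleStress_eq_zero {Sh : ∀ i, Submodule ℝ (G.Stress i)}
    {Uh : ∀ i, Submodule ℝ (G.L2Vec i)} (h : G.DivCompatible Sh Uh) (ε : G.I → ℝ)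
    {σ : G.StressSpace} (hσ : ∀ i, σ i ∈ Sh i)
    -- Rotations enter only through the test value `0`, which lies in every choice of discrete
    -- rotation spaces, so these spaces do not appear here.
    (hb : ∀ v : G.DispSpace, (∀ i, v i ∈ Uh i) → G.formB ε σ v 0 = 0) (i : G.I) :
    G.mdDiv (G.scaleStress ε σ) i = 0 := by
  have h0 := hb _ (G.mdDiv_scaleStress_mem h ε hσ)
  simp only [formB, Pi.zero_apply, inner_zero_right, Finset.sum_const_zero, add_zero] at h0
  -- What remains of `b` is a sum over the manifolds of inner products of `𝔇 · εσ` with itself. Each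
  -- is nonnegative, so each is zero.
  rw [Finset.sum_eq_zero_iff_of_nonneg fun _ _ => real_inner_self_nonneg] at h0
  exact inner_self_eq_zero.1 (h0 i (Finset.mem_univ i))

/-- On stresses with vanishing mixed-dimensional divergence, the weighted norm is the norm on `Ω × Γ`. -/
theorem stressNorm_eq_normBI {ε : G.I → ℝ} {σ : G.StressSpace}
    (h : ∀ i, G.mdDiv (G.scaleStress ε σ) i = 0) :
    G.stressNorm ε σ = G.normBI (G.toBulkInterface σ) := by
  -- The divergence term drops out whatever the value of `(epsMax ε i)⁻¹`. The other two sums match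
  -- once `⟪x, x⟫` is read as `‖x‖ ^ 2`.
  simp only [stressNorm, normBI, innerBI, toBulkInterface, h, smul_zero, norm_zero,
    real_inner_self_eq_norm_sq, ne_eq, OfNat.ofNat_ne_zero, not_false_eq_true, zero_pow,
    Finset.sum_const_zero, add_zero]

end MixedDimGeometry

/-- The uniformity lies in the order of the quantifiers: `C` is fixed before `ε`, the material law
`A` and the discrete spaces, so it can depend only on `G`, `M` and `α`. -/
theorem mainTheorem10 {n : ℕ} (hn : n = 2 ∨ n = 3) (G : MixedDimGeometry n)
    (M α : ℝ) (hα : 0 < α) :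
    ∃ C : ℝ, 0 < C ∧
      ∀ (ε : G.I → ℝ), G.IsScaling ε →
      ∀ (A : G.StressSpace →ₗ[ℝ] G.BulkInterface), G.IsContinuousCoercive ε A M α →
      ∀ (Sh : ∀ i, Submodule ℝ (G.Stress i)) (Uh : ∀ i, Submodule ℝ (G.L2Vec i))
        (Rh : ∀ i, Submodule ℝ (G.L2Skw i)), G.DivCompatible Sh Uh →
      ∀ σ : G.StressSpace, (∀ i, σ i ∈ Sh i) →
        (∀ (v : G.DispSpace) (s : G.RotSpace), (∀ i, v i ∈ Uh i) → (∀ i, s i ∈ Rh i) →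
          G.formB ε σ v s = 0) →
        C * G.stressNorm ε σ ^ 2 ≤ G.formA ε A σ σ := by
  -- The coercivity constant is kept without loss, because the two norms are equal on the discrete
  -- kernel and not merely equivalent.
  refine ⟨α, hα, fun ε _ A hA Sh Uh Rh hSU σ hσ hb => ?_⟩
  rw [G.stressNorm_eq_normBI (G.mdDiv_scaleStress_eq_zero hSU ε hσ
    fun v hv => hb v 0 hv fun i => (Rh i).zero_mem)]
  -- With the weighted norm replaced by the norm on `Ω × Γ`, the goal is literally the coercivity of
  -- `𝔄` at `σ`.
  exact hA.2 σ
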